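/- Let $\mathbb{R}^{0,2,1}$ denote $\mathbb{R}^3$ with coordinates $(x,y,z)$, the degenerate metric $(\cdot,\cdot)=dx^2+dy^2$ and the canonical flat connection $d$, and let $\xi=(0,0,1)$. Let $M$ be a connected two-dimensional smooth manifold and let $f:M\to\mathbb{R}^{0,2,1}$ be a $C^\infty$ immersion whose induced metric $g=f^*(\cdot,\cdot)$ is positive definite. Its second fundamental form $h$ is defined by the decomposition $d_XY=\nabla_XY+h(X,Y)\,\xi$ for tangent vector fields $X,Y$ of $M$, where $\nabla_XY$ is tangent to $M$. Suppose that $f$ is $d$-minimal, i.e. $\tfrac12\operatorname{tr}_g h=\tfrac12 g^{ij}h_{ij}=0$ on $M$, and complete, i.e. the Riemannian manifold $(M,g)$ is complete. Then there is a smooth harmonic function $\psi:\mathbb{R}^2\to\mathbb{R}$ such that \[ f(M)=\{(u,v,\psi(u,v)) \mid (u,v)\in\mathbb{R}^2\}. \] -/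

import Mathlib

open scoped Manifold ContDiff Topology ENNReal

namespace Isotropic

noncomputable section

/-- The Euclidean plane, which is also the model space of two-dimensional manifolds. -/
abbrev Plane : Type := EuclideanSpace ℝ (Fin 2)

/-- The underlying smooth manifold `ℝ³` of `ℝ^{0,2,1}`, with coordinates `x = p 0`, `y = p 1`,
`z = p 2`. Its Euclidean norm is used only for calculus. -/
abbrev Space : Type := EuclideanSpace ℝ (Fin 3)

/-- The degenerate metric `dx² + dy²` of `ℝ^{0,2,1}`. -/
def form (v w : Space) : ℝ := v 0 * w 0 + v 1 * w 1

/-- The constant transversal vector field `ξ = (0, 0, 1)`. -/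
def xi : Space := !₂[0, 0, 1]

section Surface

variable {M : Type*} [TopologicalSpace M] [ChartedSpace Plane M]

/-- The differential `df_x : T_x M → ℝ³`. -/
def df (f : M → Space) (x : M) : TangentSpace (𝓡 2) x →L[ℝ] Space :=
  mfderiv (𝓡 2) (𝓡 3) f x

/-- The induced metric `g = f^* (dx² + dy²)`. -/
def inducedMetric (f : M → Space) (x : M) (v w : TangentSpace (𝓡 2) x) : ℝ :=
  form (df f x v) (df f x w)

/-- A non-degenerate immersion (or non-degenerate surface): a `C^∞` immersion whose induced metric
is positive definite. -/
structure IsNondegenerate (f : M → Space) : Prop where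
  contMDiff : ContMDiff (𝓡 2) (𝓡 3) ∞ f
  injective_df : ∀ x, Function.Injective (df f x)
  pos_def : ∀ (x : M) (v : TangentSpace (𝓡 2) x), v ≠ 0 → 0 < inducedMetric f x v v

/-- The coefficient `c` of `ξ` in the decomposition `w = df_x t + c ξ` of a vector along
`T_{f(x)} ℝ³ = df_x (T_x M) ⊕ ℝ ξ`; it exists and is unique if `f` is non-degenerate. -/
def normalCoeff (f : M → Space) (x : M) (w : Space) : ℝ :=
  Classical.epsilon fun c : ℝ => ∃ t : TangentSpace (𝓡 2) x, w = df f x t + c • xi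

/-- `d_X Y` at `x`, where `d` is the canonical flat connection of `ℝ³` and `Y` is regarded as the
`ℝ³`-valued function `y ↦ df_y (Y y)`. -/
def ambientDeriv (f : M → Space) (X Y : ∀ x : M, TangentSpace (𝓡 2) x) (x : M) : Space :=
  mfderiv (𝓡 2) 𝓘(ℝ, Space) (fun y => df f y (Y y)) x (X x)

/-- The second fundamental form `h(X, Y)` at `x`, defined by `d_X Y = ∇_X Y + h(X, Y) ξ`. -/
def secondFundForm (f : M → Space) (X Y : ∀ x : M, TangentSpace (𝓡 2) x) (x : M) : ℝ :=
  normalCoeff f x (ambientDeriv f X Y x)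

/-- The coordinate vector field `∂_i` of a chart `φ` (meaningful on `φ.source`). -/
def coordField (φ : OpenPartialHomeomorph M Plane) (i : Fin 2) (x : M) : TangentSpace (𝓡 2) x :=
  (mfderiv (𝓡 2) 𝓘(ℝ, Plane) φ x).inverse (EuclideanSpace.single i (1 : ℝ))

/-- The matrix `g_{ij} = g(∂_i, ∂_j)` at `x` in the chart `φ`. -/
def metricMatrix (f : M → Space) (φ : OpenPartialHomeomorph M Plane) (x : M) :
    Matrix (Fin 2) (Fin 2) ℝ :=
  Matrix.of fun i j => inducedMetric f x (coordField φ i x) (coordField φ j x)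

/-- The matrix `h_{ij} = h(∂_i, ∂_j)` at `x` in the chart `φ`. -/
def secondFundMatrix (f : M → Space) (φ : OpenPartialHomeomorph M Plane) (x : M) :
    Matrix (Fin 2) (Fin 2) ℝ :=
  Matrix.of fun i j => secondFundForm f (coordField φ i) (coordField φ j) x

/-- The mean curvature `(1/2) tr_g h = (1/2) g^{ij} h_{ij}` at `x`, computed in the chart `φ`. -/
def meanCurvature (f : M → Space) (φ : OpenPartialHomeomorph M Plane) (x : M) : ℝ :=
  1 / 2 * ∑ i, ∑ j, (metricMatrix f φ x)⁻¹ i j * secondFundMatrix f φ x i j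

/-- A `d`-minimal surface: a non-degenerate surface whose mean curvature vanishes (in every chart
of the smooth structure; the value does not depend on the chart). -/
structure IsDMinimal (f : M → Space) : Prop where
  nondegenerate : IsNondegenerate f
  meanCurvature_eq_zero : ∀ φ ∈ IsManifold.maximalAtlas (𝓡 2) ∞ M, ∀ x ∈ φ.source,
    meanCurvature f φ x = 0

/-- The length `√g(v, v)` of tangent vectors with respect to the induced metric. -/
abbrev inducedENorm (f : M → Space) (x : M) : ENorm (TangentSpace (𝓡 2) x) :=
  ⟨fun v => ENNReal.ofReal (√(inducedMetric f x v v))⟩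

/-- The Riemannian distance of the induced metric: the infimum of the lengths of `C^1` paths. -/
def inducedEDist (f : M → Space) (x y : M) : ℝ≥0∞ :=
  letI := inducedENorm f
  Manifold.riemannianEDist (𝓡 2) x y

/-- The surface is complete: every sequence of `M` which is Cauchy for the Riemannian distance of
the induced metric converges in `M`. -/
def IsCompleteSurface (f : M → Space) : Prop :=
  ∀ u : ℕ → M,
    (∀ ε : ℝ≥0∞, 0 < ε → ∃ N : ℕ, ∀ m ≥ N, ∀ n ≥ N, inducedEDist f (u m) (u n) < ε) →
    ∃ x : M, Filter.Tendsto u Filter.atTop (𝓝 x)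

end Surface

end

end Isotropic

/- The projection `(x, y, z) ↦ (x, y)` turns the degenerate metric into the Euclidean one, so its
composition with `f` is a local isometry from `(M, g)` to the plane. Completeness of `g` allows line
segments to be lifted through it, and since `M` is connected it is a diffeomorphism. Hence `f(M)` is
the graph of a smooth function `ψ`. In the resulting global chart `g_{ij} = δ_{ij}`, and because `ξ`
is vertical and constant, `h_{ij} = ∂_i ∂_j ψ`; so `d`-minimality says that `Δψ = 0`. -/

namespace Isotropic

open Set Filter Manifold NNReal

section InverseFunctionTheorem

variable {𝕜 E E' M : Type*} [RCLike 𝕜] [NormedAddCommGroup E] [NormedSpace 𝕜 E]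
  [NormedAddCommGroup E'] [NormedSpace 𝕜 E'] [TopologicalSpace M] [ChartedSpace E M]
  {n : WithTop ℕ∞} {F : M → E'}

theorem isInvertible_fderiv_comp_symm (hF : MDifferentiable 𝓘(𝕜, E) 𝓘(𝕜, E') F)
    (hinv : ∀ x, (mfderiv 𝓘(𝕜, E) 𝓘(𝕜, E') F x).IsInvertible) {φ : OpenPartialHomeomorph M E}
    (hφ : φ.MDifferentiable 𝓘(𝕜, E) 𝓘(𝕜, E)) {y : E} (hy : y ∈ φ.target) :
    (fderiv 𝕜 (F ∘ φ.symm) y).IsInvertible := by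
  rw [← mfderiv_eq_fderiv, mfderiv_comp y (hF _) (hφ.mdifferentiableAt_symm hy)]
  exact (hinv _).comp ⟨hφ.symm.mfderiv hy, rfl⟩

theorem isLocalDiffeomorph_of_isInvertible_mfderiv [CompleteSpace E] [IsManifold 𝓘(𝕜, E) n M]
    (hF : ContMDiff 𝓘(𝕜, E) 𝓘(𝕜, E') n F) (hn : n ≠ 0)
    (hinv : ∀ x, (mfderiv 𝓘(𝕜, E) 𝓘(𝕜, E') F x).IsInvertible) :
    IsLocalDiffeomorph 𝓘(𝕜, E) 𝓘(𝕜, E') n F := by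
  intro x
  have : IsManifold 𝓘(𝕜, E) 1 M := .of_le (ENat.one_le_iff_ne_zero_withTop.2 hn)
  set φ := chartAt E x
  have hx : φ x ∈ φ.target := mem_chart_target E x
  have hφ : φ ∈ IsManifold.maximalAtlas 𝓘(𝕜, E) n M := IsManifold.chart_mem_maximalAtlas x
  have hφ_symm : ContMDiffOn 𝓘(𝕜, E) 𝓘(𝕜, E) n φ.symm φ.target :=
    contMDiffOn_symm_of_mem_maximalAtlas hφ
  have hG : ∀ y ∈ φ.target, ContDiffAt 𝕜 n (F ∘ φ.symm) y := fun y hy =>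
    (hF.contMDiffAt.comp y (hφ_symm.contMDiffAt (φ.open_target.mem_nhds hy))).contDiffAt
  have hG' : ∀ y ∈ φ.target, ∃ A : E ≃L[𝕜] E', HasFDerivAt (F ∘ φ.symm) (A : E →L[𝕜] E') y := by
    intro y hy
    obtain ⟨A, hA⟩ := isInvertible_fderiv_comp_symm (hF.mdifferentiable hn) hinv
      (mdifferentiable_of_mem_atlas (chart_mem_atlas E x)) hy
    exact ⟨A, hA ▸ ((hG y hy).differentiableAt hn).hasFDerivAt⟩
  obtain ⟨A, hA⟩ := hG' _ hx
  let e := (hG _ hx).toOpenPartialHomeomorph _ hA hn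
  have hxe : φ x ∈ e.source := ContDiffAt.mem_toOpenPartialHomeomorph_source _ hA hn
  have heq : EqOn F (φ.trans e) (φ.trans e).source := by
    intro y hy
    rw [OpenPartialHomeomorph.trans_source] at hy
    exact congrArg F (φ.left_inv hy.1).symm
  have he_symm : ContMDiffOn 𝓘(𝕜, E') 𝓘(𝕜, E) n (φ.trans e).symm (φ.trans e).target := by
    intro y hy
    rw [OpenPartialHomeomorph.trans_target] at hy
    obtain ⟨B, hB⟩ := hG' _ hy.2
    exact ((hφ_symm.contMDiffAt (φ.open_target.mem_nhds hy.2)).comp y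
      (e.contDiffAt_symm hy.1 hB (hG _ hy.2)).contMDiffAt).contMDiffWithinAt
  exact ⟨{ toPartialEquiv := (φ.trans e).toPartialEquiv
           open_source := (φ.trans e).open_source
           open_target := (φ.trans e).open_target
           contMDiffOn_toFun := hF.contMDiffOn.congr heq.symm
           contMDiffOn_invFun := he_symm },
    by simpa [OpenPartialHomeomorph.trans_source] using ⟨mem_chart_source E x, hxe⟩, heq⟩

end InverseFunctionTheorem

section PathLifting

variable {M X : Type*} [TopologicalSpace M]

/-- `Γ` is a lift through `F`, over the set of times `s`, of the curve `γ`, starting at `p`. -/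
structure IsLiftOn (F : M → X) (γ : ℝ → X) (p : M) (Γ : ℝ → M) (s : Set ℝ) : Prop where
  continuousOn : ContinuousOn Γ s
  map_zero : Γ 0 = p
  eqOn_comp : EqOn (F ∘ Γ) γ s

variable {F : M → X} {γ : ℝ → X} {p : M} {Γ Γ' : ℝ → M} {s t : Set ℝ} {a b T : ℝ}

namespace IsLiftOn

theorem mono (h : IsLiftOn F γ p Γ t) (hst : s ⊆ t) : IsLiftOn F γ p Γ s :=
  ⟨h.continuousOn.mono hst, h.map_zero, h.eqOn_comp.mono hst⟩

theorem const (h : F p = γ 0) : IsLiftOn F γ p (fun _ => p) (Icc 0 0) :=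
  ⟨continuousOn_const, rfl, fun t ht => by rw [le_antisymm ht.2 ht.1]; exact h⟩

variable [TopologicalSpace X]

theorem eqOn [T2Space M] (hF : IsLocalHomeomorph F) (h : IsLiftOn F γ p Γ s)
    (h' : IsLiftOn F γ p Γ' s) (hs : IsPreconnected s) (hs0 : 0 ∈ s) : EqOn Γ Γ' s :=
  (T2Space.isSeparatedMap F).eqOn_of_comp_eqOn hF.isLocallyInjective hs h.continuousOn
    h'.continuousOn (h.eqOn_comp.trans h'.eqOn_comp.symm) hs0 (h.map_zero.trans h'.map_zero.symm)

theorem exists_extend_of_mapsTo (hγ : Continuous γ) (h : IsLiftOn F γ p Γ (Icc 0 a)) (ha : 0 ≤ a)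
    (hab : a ≤ b) (e : OpenPartialHomeomorph M X) (he : EqOn e F e.source) (hΓa : Γ a ∈ e.source)
    (hmaps : MapsTo γ (Icc a b) e.target) : ∃ Γ', IsLiftOn F γ p Γ' (Icc 0 b) := by
  classical
  have hagree : e.symm (γ a) = Γ a := by
    rw [← h.eqOn_comp (right_mem_Icc.2 ha), Function.comp_apply, ← he hΓa, e.left_inv hΓa]
  have hcont : ContinuousOn (e.symm ∘ γ) (Icc a b) :=
    e.continuousOn_symm.comp hγ.continuousOn hmaps
  refine ⟨fun t => if t ≤ a then Γ t else e.symm (γ t), ?_, by simp [ha, h.map_zero], ?_⟩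
  · rw [← Icc_union_Icc_eq_Icc ha hab]
    refine (h.continuousOn.congr fun t ht => if_pos ht.2).union_of_isClosed
      (hcont.congr fun t ht => ?_) isClosed_Icc isClosed_Icc
    rcases ht.1.eq_or_lt with rfl | hlt
    · simp [hagree]
    · exact if_neg hlt.not_ge
  · intro t ht
    by_cases hta : t ≤ a
    · simpa [hta] using h.eqOn_comp ⟨ht.1, hta⟩
    · have htarget := hmaps ⟨(not_le.1 hta).le, ht.2⟩
      simp only [Function.comp_apply, hta, if_false]
      rw [← he (e.map_target htarget), e.right_inv htarget]

theorem exists_nhds_extend (hF : IsLocalHomeomorph F) (hγ : Continuous γ) {x : M}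
    (hx : F x = γ T) :
    ∃ U ∈ 𝓝 x, ∃ V ∈ 𝓝 T, ∀ ⦃a b : ℝ⦄ ⦃Γ : ℝ → M⦄, 0 ≤ a → a ≤ b → Icc a b ⊆ V → Γ a ∈ U →
      IsLiftOn F γ p Γ (Icc 0 a) → ∃ Γ', IsLiftOn F γ p Γ' (Icc 0 b) := by
  obtain ⟨e, hxe, rfl⟩ := hF x
  refine ⟨e.source, e.open_source.mem_nhds hxe, γ ⁻¹' e.target,
    hγ.continuousAt.preimage_mem_nhds (e.open_target.mem_nhds (hx ▸ e.map_source hxe)), ?_⟩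
  exact fun a b Γ ha hab hV hU h => h.exists_extend_of_mapsTo hγ ha hab e (eqOn_refl _ _) hU hV

theorem exists_Ico_of_forall_Icc [T2Space M] (hF : IsLocalHomeomorph F) (hT : 0 < T)
    (h : ∀ t ∈ Ico 0 T, ∃ Γ, IsLiftOn F γ p Γ (Icc 0 t)) : ∃ Γ, IsLiftOn F γ p Γ (Ico 0 T) := by
  have : Nonempty M := ⟨p⟩
  choose! Γ hΓ using h
  have hcompat : ∀ t ∈ Ico 0 T, EqOn (fun r => Γ r r) (Γ t) (Icc 0 t) := fun t ht r hr =>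
    (hΓ r ⟨hr.1, hr.2.trans_lt ht.2⟩).eqOn hF ((hΓ t ht).mono (Icc_subset_Icc_right hr.2))
      isPreconnected_Icc (left_mem_Icc.2 hr.1) (right_mem_Icc.2 hr.1)
  refine ⟨fun t => Γ t t, fun t ht => ?_, (hΓ 0 ⟨le_rfl, hT⟩).map_zero,
    fun t ht => (hΓ t ht).eqOn_comp (right_mem_Icc.2 ht.1)⟩
  obtain ⟨r, htr, hrT⟩ := exists_between ht.2
  have hr : r ∈ Ico 0 T := ⟨ht.1.trans htr.le, hrT⟩
  have hnhds : Icc 0 r ∈ 𝓝[Ico 0 T] t :=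
    mem_nhdsWithin.2 ⟨Iio r, isOpen_Iio, htr, fun u hu => ⟨hu.2.1, hu.1.le⟩⟩
  exact (((hΓ r hr).continuousOn.congr (hcompat r hr)) t ⟨ht.1, htr.le⟩).mono_of_mem_nhdsWithin
    hnhds

theorem exists_Icc_of_mapClusterPt [T2Space X] (hF : IsLocalHomeomorph F) (hγ : Continuous γ)
    (hT : 0 < T) (h : IsLiftOn F γ p Γ (Ico 0 T)) {x : M} (hx : MapClusterPt x (𝓝[<] T) Γ) :
    ∃ Γ', IsLiftOn F γ p Γ' (Icc 0 T) := by
  have hFx : F x = γ T := by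
    have hIco : ∀ᶠ t in 𝓝[<] T, t ∈ Ico 0 T := Ico_mem_nhdsLT hT
    have hclus : MapClusterPt (F x) (𝓝[<] T) γ :=
      (hx.continuousAt_comp hF.continuous.continuousAt).congrFun
        (hIco.mono fun t ht => h.eqOn_comp ht)
    exact eq_of_nhds_neBot (hclus.neBot.mono
      (inf_le_inf_left _ (hγ.continuousAt.mono_left nhdsWithin_le_nhds)))
  obtain ⟨U, hU, V, hV, hext⟩ := exists_nhds_extend (p := p) hF hγ hFx
  obtain ⟨c, hcT, hcV⟩ := exists_Ioc_subset_of_mem_nhds hV (exists_lt T)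
  have hev : ∀ᶠ t in 𝓝[<] T, t ∈ Ioo (max c 0) T := Ioo_mem_nhdsLT (max_lt hcT hT)
  obtain ⟨t, htU, hct, htT⟩ := ((hx.frequently hU).and_eventually hev).exists
  obtain ⟨hct, ht0⟩ := max_lt_iff.1 hct
  exact hext ht0.le htT.le (fun r hr => hcV ⟨hct.trans_le hr.1, hr.2⟩) htU
    (h.mono fun r hr => ⟨hr.1, hr.2.trans_lt htT⟩)

theorem exists_Icc_of_forall_mapClusterPt [T2Space M] [T2Space X] (hF : IsLocalHomeomorph F)
    (hγ : Continuous γ) (hp : F p = γ 0) (hb : 0 ≤ b)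
    (hclus : ∀ T ∈ Ioc 0 b, ∀ Γ, IsLiftOn F γ p Γ (Ico 0 T) → ∃ x, MapClusterPt x (𝓝[<] T) Γ) :
    ∃ Γ, IsLiftOn F γ p Γ (Icc 0 b) := by
  set s : Set ℝ := {T | ∃ Γ, IsLiftOn F γ p Γ (Icc 0 T)}
  suffices h : Icc 0 b ⊆ s from h (right_mem_Icc.2 hb)
  have hs_down : ∀ ⦃T⦄, T ∈ s → ∀ ⦃t⦄, t ≤ T → t ∈ s := fun T ⟨Γ, hΓ⟩ t ht =>
    ⟨Γ, hΓ.mono (Icc_subset_Icc_right ht)⟩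
  refine IsClosed.Icc_subset_of_forall_exists_gt ?_ ⟨_, const hp⟩ ?_
  · refine isClosed_of_closure_subset fun T hT => ?_
    have hT_mem : T ∈ Icc 0 b := isClosed_Icc.closure_subset_iff.2 inter_subset_right hT
    refine ⟨?_, hT_mem⟩
    have hlt : ∀ t < T, t ∈ s := fun t ht => by
      obtain ⟨r, hr, htr⟩ := (mem_closure_iff_nhds.1 hT) (Ioi t) (Ioi_mem_nhds ht)
      exact hs_down htr.1 (le_of_lt hr)
    rcases hT_mem.1.eq_or_lt with rfl | hT0
    · exact ⟨_, const hp⟩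
    · obtain ⟨Γ, hΓ⟩ := exists_Ico_of_forall_Icc hF hT0 fun t ht => hlt t ht.2
      obtain ⟨x, hx⟩ := hclus T ⟨hT0, hT_mem.2⟩ Γ hΓ
      exact hΓ.exists_Icc_of_mapClusterPt hF hγ hT0 hx
  · rintro T ⟨⟨Γ, hΓ⟩, hT⟩ y hy
    obtain ⟨U, hU, V, hV, hext⟩ :=
      exists_nhds_extend (p := p) hF hγ (hΓ.eqOn_comp (right_mem_Icc.2 hT.1))
    obtain ⟨c, hTc, hcV⟩ := exists_Ico_subset_of_mem_nhds hV (exists_gt T)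
    obtain ⟨r, hTr, hr⟩ := exists_between (lt_min hy hTc)
    obtain ⟨hry, hrc⟩ := lt_min_iff.1 hr
    exact ⟨r, hext hT.1 hTr.le (fun t ht => hcV ⟨ht.1, ht.2.trans_lt hrc⟩) (mem_of_mem_nhds hU) hΓ,
      hTr, hry.le⟩

end IsLiftOn

end PathLifting

section SegmentLifting

variable {E M : Type*} [AddCommGroup E] [Module ℝ E] [TopologicalSpace E]
  [IsTopologicalAddGroup E] [ContinuousSMul ℝ E] [TopologicalSpace M] [T2Space M] {F : M → E}

theorem exists_section_of_isLiftOn_lineMap (hF : IsLocalHomeomorph F) {p : M}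
    (hlift : ∀ q, ∃ Γ, IsLiftOn F (AffineMap.lineMap (F p) q) p Γ (Icc 0 1)) :
    ∃ σ : E → M, Continuous σ ∧ Function.RightInverse σ F ∧ σ (F p) = p := by
  choose Γ hΓ using hlift
  have hcont : Continuous fun z : unitInterval × E => Γ z.2 z.1 := by
    refine hF.continuous_lift (T2Space.isSeparatedMap F)
      ⟨fun z => AffineMap.lineMap (F p) z.2 (z.1 : ℝ), ?_⟩ ?_ ?_ ?_
    · simp only [AffineMap.lineMap_apply_module']
      fun_prop
    · exact funext fun z => (hΓ z.2).eqOn_comp z.1.2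
    · exact continuous_const.congr fun q => (hΓ q).map_zero.symm
    · exact fun q => (hΓ q).continuousOn.comp_continuous continuous_subtype_val Subtype.prop
  refine ⟨fun q => Γ q 1, hcont.comp (Continuous.prodMk_right (1 : unitInterval)),
    fun q => ?_, ?_⟩
  · simpa using (hΓ q).eqOn_comp (right_mem_Icc.2 zero_le_one)
  · have hconst : IsLiftOn F (AffineMap.lineMap (F p) (F p)) p (fun _ => p) (Icc (0 : ℝ) 1) :=
      ⟨continuousOn_const, rfl, fun t _ => by simp⟩
    exact (hΓ (F p)).eqOn hF hconst isPreconnected_Icc (left_mem_Icc.2 zero_le_one)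
      (right_mem_Icc.2 zero_le_one)

theorem exists_homeomorph_of_isLiftOn_lineMap [ConnectedSpace M] (hF : IsLocalHomeomorph F)
    (hlift : ∀ p q, ∃ Γ, IsLiftOn F (AffineMap.lineMap (F p) q) p Γ (Icc 0 1)) :
    ∃ H : M ≃ₜ E, ⇑H = F := by
  obtain ⟨p⟩ : Nonempty M := inferInstance
  obtain ⟨σ, hσ, hright, hp⟩ := exists_section_of_isLiftOn_lineMap hF (hlift p)
  have hleft : σ ∘ F = id :=
    (T2Space.isSeparatedMap F).eq_of_comp_eq hF.isLocallyInjective (hσ.comp hF.continuous)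
      continuous_id (funext fun x => hright (F x)) p hp
  exact ⟨⟨⟨F, σ, congrFun hleft, hright⟩, hF.continuous, hσ⟩, rfl⟩

end SegmentLifting

theorem mfderiv_apply_of_eventuallyEq_comp {𝕜 V W E H M : Type*} [NontriviallyNormedField 𝕜]
    [NormedAddCommGroup V] [NormedSpace 𝕜 V] [NormedAddCommGroup W] [NormedSpace 𝕜 W]
    [NormedAddCommGroup E] [NormedSpace 𝕜 E] [TopologicalSpace H] {I : ModelWithCorners 𝕜 E H}
    [TopologicalSpace M] [ChartedSpace H M] {u : M → V} {g : M → W} {G : V → W} {G' : V →L[𝕜] W}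
    {x : M} (hG : HasFDerivAt G G' (u x)) (hu : MDifferentiableAt I 𝓘(𝕜, V) u x)
    (hg : g =ᶠ[𝓝 x] G ∘ u) (v : TangentSpace I x) :
    mfderiv I 𝓘(𝕜, W) g x v = G' (mfderiv I 𝓘(𝕜, V) u x v) :=
  congrArg (· v) ((hG.hasMFDerivAt.comp x hu.hasMFDerivAt).congr_of_eventuallyEq hg).mfderiv

theorem contMDiffOn_of_comp_isLocalDiffeomorph {𝕜 : Type*} [NontriviallyNormedField 𝕜]
    {E₁ E₂ E₃ H₁ H₂ H₃ M₁ M₂ M₃ : Type*}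
    [NormedAddCommGroup E₁] [NormedSpace 𝕜 E₁] [TopologicalSpace H₁] {I₁ : ModelWithCorners 𝕜 E₁ H₁}
    [TopologicalSpace M₁] [ChartedSpace H₁ M₁]
    [NormedAddCommGroup E₂] [NormedSpace 𝕜 E₂] [TopologicalSpace H₂] {I₂ : ModelWithCorners 𝕜 E₂ H₂}
    [TopologicalSpace M₂] [ChartedSpace H₂ M₂]
    [NormedAddCommGroup E₃] [NormedSpace 𝕜 E₃] [TopologicalSpace H₃] {I₃ : ModelWithCorners 𝕜 E₃ H₃}
    [TopologicalSpace M₃] [ChartedSpace H₃ M₃] {n : WithTop ℕ∞} {F : M₂ → M₃} {Γ : M₁ → M₂}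
    {s : Set M₁} (hF : IsLocalDiffeomorph I₂ I₃ n F) (hΓ : ContinuousOn Γ s)
    (h : ContMDiffOn I₁ I₃ n (F ∘ Γ) s) : ContMDiffOn I₁ I₂ n Γ s := by
  intro t ht
  have hloc := hF (Γ t)
  have hleft : hloc.localInverse ∘ F ∘ Γ =ᶠ[𝓝[s] t] Γ :=
    (hΓ t ht).eventually hloc.localInverse_eventuallyEq_left
  exact (hloc.localInverse_contMDiffAt.comp_contMDiffWithinAt t (h t ht)).congr_of_eventuallyEq
    hleft.symm (hleft.self_of_nhdsWithin ht).symm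

section RiemannianLifting

variable {E E' H : Type*} [NormedAddCommGroup E] [NormedSpace ℝ E] [NormedAddCommGroup E']
  [NormedSpace ℝ E'] [TopologicalSpace H] {I : ModelWithCorners ℝ E H} {M : Type*}
  [TopologicalSpace M] [ChartedSpace H M] [∀ x : M, ENorm (TangentSpace I x)]
  {n : WithTop ℕ∞} {F : M → E'} {γ : ℝ → E'} {Γ : ℝ → M} {p : M} {C K : ℝ≥0} {a b T : ℝ}

variable (I M) in
/-- Completeness of the Riemannian distance in the form that Cauchy sequences converge in the
manifold topology, which need not be the topology of that distance. -/
def IsRiemannianComplete : Prop :=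
  ∀ u : ℕ → M, (∀ ε > 0, ∃ N, ∀ k ≥ N, ∀ l ≥ N, riemannianEDist I (u k) (u l) < ε) →
    ∃ x, Tendsto u atTop (𝓝 x)

theorem enorm_mfderiv_lift_le (hF : IsLocalDiffeomorph I 𝓘(ℝ, E') n F) (hn : n ≠ 0)
    (hexp : ∀ x v, ‖v‖ₑ ≤ C * enorm (E := E') (mfderiv I 𝓘(ℝ, E') F x v))
    (hγ : LipschitzWith K γ) {t : ℝ} (hΓ : MDifferentiableAt 𝓘(ℝ, ℝ) I Γ t)
    (hlift : F ∘ Γ =ᶠ[𝓝 t] γ) :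
    ‖mfderiv 𝓘(ℝ, ℝ) I Γ t 1‖ₑ ≤ C * K := by
  have hcomp : mfderiv I 𝓘(ℝ, E') F (Γ t) (mfderiv 𝓘(ℝ, ℝ) I Γ t 1) = deriv γ t := by
    rw [← mfderiv_comp_apply t (hF.mdifferentiable hn _) hΓ, hlift.mfderiv_eq, mfderiv_eq_fderiv]
    exact (fderiv_apply_one_eq_deriv : fderiv ℝ γ t 1 = deriv γ t)
  refine (hexp _ _).trans (mul_le_mul_right ?_ _)
  rw [hcomp]
  exact enorm_le_coe.2 (norm_deriv_le_of_lipschitz hγ)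

variable [∀ x : M, ENormSMulClass ℝ (TangentSpace I x)]

theorem riemannianEDist_lift_le_of_le (hF : IsLocalDiffeomorph I 𝓘(ℝ, E') n F) (hn : n ≠ 0)
    (hexp : ∀ x v, ‖v‖ₑ ≤ C * enorm (E := E') (mfderiv I 𝓘(ℝ, E') F x v)) (hγ : LipschitzWith K γ)
    (hγn : ContDiff ℝ n γ) (hΓ : ContinuousOn Γ (Icc a b)) (hlift : EqOn (F ∘ Γ) γ (Icc a b))
    (hab : a ≤ b) : riemannianEDist I (Γ a) (Γ b) ≤ C * K * edist a b := by
  have hΓn : ContMDiffOn 𝓘(ℝ, ℝ) I n Γ (Icc a b) :=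
    contMDiffOn_of_comp_isLocalDiffeomorph hF hΓ (hγn.contMDiff.contMDiffOn.congr hlift)
  calc riemannianEDist I (Γ a) (Γ b)
      ≤ pathELength I Γ a b :=
        riemannianEDist_le_pathELength (hΓn.of_le (ENat.one_le_iff_ne_zero_withTop.2 hn)) rfl rfl
          hab
    _ = ∫⁻ t in Ioo a b, ‖mfderiv 𝓘(ℝ, ℝ) I Γ t 1‖ₑ := pathELength_eq_lintegral_mfderiv_Ioo
    _ ≤ ∫⁻ _ in Ioo a b, C * K := by
        refine MeasureTheory.setLIntegral_mono' measurableSet_Ioo fun t ht => ?_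
        have hnhds : Icc a b ∈ 𝓝 t := Icc_mem_nhds ht.1 ht.2
        exact enorm_mfderiv_lift_le hF hn hexp hγ
          ((hΓn.contMDiffAt hnhds).mdifferentiableAt hn) (hlift.eventuallyEq_of_mem hnhds)
    _ = C * K * edist a b := by
        rw [MeasureTheory.setLIntegral_const, Real.volume_Ioo, edist_comm, edist_dist,
          Real.dist_eq, abs_of_nonneg (sub_nonneg.2 hab)]

theorem riemannianEDist_lift_le (hF : IsLocalDiffeomorph I 𝓘(ℝ, E') n F) (hn : n ≠ 0)
    (hexp : ∀ x v, ‖v‖ₑ ≤ C * enorm (E := E') (mfderiv I 𝓘(ℝ, E') F x v)) (hγ : LipschitzWith K γ)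
    (hγn : ContDiff ℝ n γ) {s : Set ℝ} [OrdConnected s] (hΓ : ContinuousOn Γ s)
    (hlift : EqOn (F ∘ Γ) γ s) (ha : a ∈ s) (hb : b ∈ s) :
    riemannianEDist I (Γ a) (Γ b) ≤ C * K * edist a b := by
  wlog hab : a ≤ b generalizing a b
  · rw [riemannianEDist_comm, edist_comm]
    exact this hb ha (le_of_not_ge hab)
  have hsub : Icc a b ⊆ s := OrdConnected.out ‹_› ha hb
  exact riemannianEDist_lift_le_of_le hF hn hexp hγ hγn (hΓ.mono hsub) (hlift.mono hsub) hab

theorem IsLiftOn.exists_mapClusterPt (hc : IsRiemannianComplete I M)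
    (hF : IsLocalDiffeomorph I 𝓘(ℝ, E') n F) (hn : n ≠ 0)
    (hexp : ∀ x v, ‖v‖ₑ ≤ C * enorm (E := E') (mfderiv I 𝓘(ℝ, E') F x v)) (hγ : LipschitzWith K γ)
    (hγn : ContDiff ℝ n γ) (hT : 0 < T) (hΓ : IsLiftOn F γ p Γ (Ico 0 T)) :
    ∃ x, MapClusterPt x (𝓝[<] T) Γ := by
  obtain ⟨t, -, htT, hlim⟩ := exists_seq_strictMono_tendsto' hT
  have hcauchy : ∀ ε > 0, ∃ N, ∀ k ≥ N, ∀ l ≥ N, riemannianEDist I (Γ (t k)) (Γ (t l)) < ε := by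
    intro ε hε
    have hsmall : ∀ᶠ r : ℝ≥0∞ in 𝓝 0, C * K * r < ε := by
      have hcont : Continuous fun r : ℝ≥0∞ => (C * K : ℝ≥0∞) * r :=
        ENNReal.continuous_const_mul (by finiteness)
      exact hcont.continuousAt.eventually_lt continuousAt_const (by simpa using hε)
    obtain ⟨δ, hδ, hδε⟩ := ENNReal.nhds_zero_basis.eventually_iff.1 hsmall
    obtain ⟨N, hN⟩ := EMetric.cauchySeq_iff.1 hlim.cauchySeq δ hδ
    exact ⟨N, fun k hk l hl => (riemannianEDist_lift_le hF hn hexp hγ hγn hΓ.continuousOn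
      hΓ.eqOn_comp (Ioo_subset_Ico_self (htT k)) (Ioo_subset_Ico_self (htT l))).trans_lt
        (hδε (hN k hk l hl))⟩
  obtain ⟨x, hx⟩ := hc _ hcauchy
  exact ⟨x, hx.mapClusterPt.of_comp
    (tendsto_nhdsWithin_iff.2 ⟨hlim, .of_forall fun k => (htT k).2⟩)⟩

theorem exists_diffeomorph_of_isRiemannianComplete [T2Space M] [ConnectedSpace M]
    (hc : IsRiemannianComplete I M) (hF : IsLocalDiffeomorph I 𝓘(ℝ, E') n F) (hn : n ≠ 0)
    (hexp : ∀ x v, ‖v‖ₑ ≤ C * enorm (E := E') (mfderiv I 𝓘(ℝ, E') F x v)) :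
    ∃ Φ : M ≃ₘ^n⟮I, 𝓘(ℝ, E')⟯ E', ⇑Φ = F := by
  obtain ⟨Φ, rfl⟩ : ∃ Φ : M ≃ₜ E', ⇑Φ = F :=
    exists_homeomorph_of_isLiftOn_lineMap hF.isLocalHomeomorph fun p q =>
      IsLiftOn.exists_Icc_of_forall_mapClusterPt hF.isLocalHomeomorph
        AffineMap.lineMap_continuous (by simp) zero_le_one fun T hT Γ hΓ =>
          hΓ.exists_mapClusterPt hc hF hn hexp (lipschitzWith_lineMap _ _)
            (ContinuousAffineMap.lineMap (R := ℝ) (F p) q).contDiff hT.1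
  have hsymm : ContMDiffOn 𝓘(ℝ, E') I n Φ.symm univ :=
    contMDiffOn_of_comp_isLocalDiffeomorph hF Φ.symm.continuous.continuousOn
      (contMDiffOn_id.congr fun q _ => Φ.apply_symm_apply q)
  exact ⟨⟨Φ.toEquiv, hF.contMDiff, contMDiffOn_univ.1 hsymm⟩, rfl⟩

end RiemannianLifting

section Projection

/-- The projection `(x, y, z) ↦ (x, y)` of `ℝ^{0,2,1}` along `ξ`. -/
noncomputable def proj : Space →L[ℝ] Plane :=
  LinearMap.toContinuousLinearMap
    { toFun := fun p => !₂[p 0, p 1]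
      map_add' := fun p q => by ext i; fin_cases i <;> simp
      map_smul' := fun c p => by ext i; fin_cases i <;> simp }

@[simp] theorem proj_apply (p : Space) : proj p = !₂[p 0, p 1] := rfl

theorem norm_proj_sq (p : Space) : ‖proj p‖ ^ 2 = form p p := by
  rw [EuclideanSpace.norm_sq_eq]
  simp [form, sq]

variable {M : Type*} [TopologicalSpace M] [ChartedSpace Plane M] {f : M → Space}

theorem mfderiv_proj_comp {x : M} (hf : MDifferentiableAt (𝓡 2) (𝓡 3) f x)
    (v : TangentSpace (𝓡 2) x) : mfderiv (𝓡 2) (𝓡 2) (proj ∘ f) x v = proj (df f x v) :=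
  mfderiv_apply_of_eventuallyEq_comp proj.hasFDerivAt hf .rfl v

theorem inducedENorm_eq_enorm_proj (f : M → Space) (x : M) (v : TangentSpace (𝓡 2) x) :
    (inducedENorm f x).enorm v = ‖proj (df f x v)‖ₑ := by
  change ENNReal.ofReal √(form (df f x v) (df f x v)) = _
  rw [← norm_proj_sq, Real.sqrt_sq (norm_nonneg _), ofReal_norm]

theorem enormSMulClass_inducedENorm (f : M → Space) (x : M) :
    letI := inducedENorm f x
    ENormSMulClass ℝ (TangentSpace (𝓡 2) x) := by
  let _ := inducedENorm f x
  refine ⟨fun c v => ?_⟩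
  rw [inducedENorm_eq_enorm_proj, inducedENorm_eq_enorm_proj, map_smul, map_smul, enorm_smul]

namespace IsNondegenerate

theorem mdifferentiable (hf : IsNondegenerate f) : MDifferentiable (𝓡 2) (𝓡 3) f :=
  hf.contMDiff.mdifferentiable (by simp)

theorem eq_zero_of_proj_df_eq_zero (hf : IsNondegenerate f) {x : M} {v : TangentSpace (𝓡 2) x}
    (hv : proj (df f x v) = 0) : v = 0 := by
  by_contra hne
  have hpos : 0 < form (df f x v) (df f x v) := hf.pos_def x v hne
  simp [← norm_proj_sq, hv] at hpos

theorem isInvertible_mfderiv_proj (hf : IsNondegenerate f) (x : M) :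
    (mfderiv (𝓡 2) (𝓡 2) (proj ∘ f) x).IsInvertible := by
  let A : Plane →L[ℝ] Plane := mfderiv (𝓡 2) (𝓡 2) (proj ∘ f) x
  have hA : Function.Injective A := (injective_iff_map_eq_zero A).2 fun v hv =>
    hf.eq_zero_of_proj_df_eq_zero ((mfderiv_proj_comp (hf.mdifferentiable x) v).symm.trans hv)
  exact ⟨(LinearEquiv.ofInjectiveEndo (A : Plane →ₗ[ℝ] Plane) hA).toContinuousLinearEquiv, rfl⟩

theorem isLocalDiffeomorph_proj [IsManifold (𝓡 2) ∞ M] (hf : IsNondegenerate f) :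
    IsLocalDiffeomorph (𝓡 2) (𝓡 2) ∞ (proj ∘ f) :=
  isLocalDiffeomorph_of_isInvertible_mfderiv (proj.contDiff.contMDiff.comp hf.contMDiff) (by simp)
    hf.isInvertible_mfderiv_proj

theorem exists_diffeomorph_proj [T2Space M] [ConnectedSpace M] [IsManifold (𝓡 2) ∞ M]
    (hf : IsNondegenerate f) (hc : IsCompleteSurface f) :
    ∃ Φ : M ≃ₘ^∞⟮𝓡 2, 𝓡 2⟯ Plane, ⇑Φ = proj ∘ f := by
  let _ := inducedENorm f
  have := enormSMulClass_inducedENorm f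
  have hisom : ∀ (x : M) (v : TangentSpace (𝓡 2) x),
      ‖v‖ₑ = enorm (E := Plane) (mfderiv (𝓡 2) (𝓡 2) (proj ∘ f) x v) := fun x v => by
    rw [inducedENorm_eq_enorm_proj, mfderiv_proj_comp (hf.mdifferentiable x)]
  exact exists_diffeomorph_of_isRiemannianComplete (C := 1) hc hf.isLocalDiffeomorph_proj (by simp)
    fun x v => by simp [hisom]

end IsNondegenerate

end Projection

section Graph

/-- The inclusion `(x, y) ↦ (x, y, 0)` of the plane as the horizontal plane of `ℝ^{0,2,1}`. -/
noncomputable def incl : Plane →L[ℝ] Space :=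
  LinearMap.toContinuousLinearMap
    { toFun := fun q => !₂[q 0, q 1, 0]
      map_add' := fun p q => by ext i; fin_cases i <;> simp
      map_smul' := fun c p => by ext i; fin_cases i <;> simp }

@[simp] theorem incl_apply (q : Plane) : incl q = !₂[q 0, q 1, 0] := rfl

theorem proj_incl_add_smul_xi (q : Plane) (c : ℝ) : proj (incl q + c • xi) = q := by
  ext i; fin_cases i <;> simp [xi]

theorem proj_xi : proj xi = 0 := by
  ext i; fin_cases i <;> simp [xi]

theorem incl_proj_add_smul_xi (p : Space) : incl (proj p) + p 2 • xi = p := by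
  ext i; fin_cases i <;> simp [xi]

theorem form_incl_add_smul_xi (v w : Plane) (c d : ℝ) :
    form (incl v + c • xi) (incl w + d • xi) = inner ℝ v w := by
  simp [form, xi, PiLp.inner_apply, Fin.sum_univ_two, mul_comm]

/-- The parametrization `(u, v) ↦ (u, v, ψ(u, v))` of the graph of `ψ`. -/
noncomputable def graphMap (ψ : Plane → ℝ) (q : Plane) : Space := incl q + ψ q • xi

theorem range_graphMap (ψ : Plane → ℝ) :
    range (graphMap ψ) = {p : Space | ∃ u v : ℝ, p = !₂[u, v, ψ !₂[u, v]]} := by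
  have hgraph : ∀ u v, graphMap ψ !₂[u, v] = !₂[u, v, ψ !₂[u, v]] := fun u v => by
    ext i; fin_cases i <;> simp [graphMap, xi]
  have hcoord : ∀ q : Plane, !₂[q 0, q 1] = q := fun q => by ext i; fin_cases i <;> simp
  refine Subset.antisymm ?_ ?_
  · rintro _ ⟨q, rfl⟩
    exact ⟨q 0, q 1, by rw [← hgraph, hcoord]⟩
  · rintro _ ⟨u, v, rfl⟩
    exact ⟨_, hgraph u v⟩

theorem eq_graphMap_comp_of_proj_eq {M : Type*} {f : M → Space} (Φ : M ≃ Plane)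
    (hΦ : ⇑Φ = proj ∘ f) : f = graphMap (fun q => f (Φ.symm q) 2) ∘ Φ := by
  funext x
  rw [Function.comp_apply, graphMap, Φ.symm_apply_apply, hΦ]
  exact (incl_proj_add_smul_xi (f x)).symm

variable {M : Type*} [TopologicalSpace M] [ChartedSpace Plane M] {f : M → Space}
  {φ : OpenPartialHomeomorph M Plane} {ψ : Plane → ℝ} {x : M}

theorem normalCoeff_df_add_smul_xi (hxi : xi ∉ range (df f x)) (t : TangentSpace (𝓡 2) x)
    (c : ℝ) : normalCoeff f x (df f x t + c • xi) = c := by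
  obtain ⟨t', ht'⟩ := Classical.epsilon_spec (p := fun d : ℝ =>
    ∃ t', df f x t + c • xi = df f x t' + d • xi) ⟨c, t, rfl⟩
  change _ = _ + normalCoeff f x (df f x t + c • xi) • xi at ht'
  set d := normalCoeff f x (df f x t + c • xi)
  by_contra hdc
  have hsub : df f x (t - t') = (d - c) • xi := by
    rw [map_sub, sub_smul, sub_eq_sub_iff_add_eq_add, ht', add_comm]
  refine hxi ⟨(d - c)⁻¹ • (t - t'), ?_⟩
  rw [map_smul, hsub, inv_smul_smul₀ (sub_ne_zero.2 hdc)]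

theorem df_of_eqOn_graphMap (hφ : φ.MDifferentiable (𝓡 2) (𝓡 2))
    (hf : EqOn f (graphMap ψ ∘ φ) φ.source) (hx : x ∈ φ.source)
    (hψ : DifferentiableAt ℝ ψ (φ x)) (v : TangentSpace (𝓡 2) x) :
    df f x v = incl (mfderiv (𝓡 2) (𝓡 2) φ x v) +
      fderiv ℝ ψ (φ x) (mfderiv (𝓡 2) (𝓡 2) φ x v) • xi := by
  have hgraph : HasFDerivAt (graphMap ψ) (incl + (fderiv ℝ ψ (φ x)).smulRight xi) (φ x) :=
    incl.hasFDerivAt.add (hψ.hasFDerivAt.smul_const xi)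
  exact mfderiv_apply_of_eventuallyEq_comp hgraph (hφ.mdifferentiableAt hx)
    (hf.eventuallyEq_of_mem (φ.open_source.mem_nhds hx)) v

theorem mfderiv_coordField (hφ : φ.MDifferentiable (𝓡 2) (𝓡 2)) (hx : x ∈ φ.source) (i : Fin 2) :
    mfderiv (𝓡 2) (𝓡 2) φ x (coordField φ i x) = EuclideanSpace.single i (1 : ℝ) :=
  ContinuousLinearMap.IsInvertible.self_apply_inverse (f := (mfderiv (𝓡 2) (𝓡 2) φ x))
    ⟨hφ.mfderiv hx, rfl⟩ _

theorem df_coordField_of_eqOn_graphMap (hφ : φ.MDifferentiable (𝓡 2) (𝓡 2))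
    (hf : EqOn f (graphMap ψ ∘ φ) φ.source) (hx : x ∈ φ.source)
    (hψ : DifferentiableAt ℝ ψ (φ x)) (i : Fin 2) :
    df f x (coordField φ i x) = incl (EuclideanSpace.single i 1) +
      fderiv ℝ ψ (φ x) (EuclideanSpace.single i 1) • xi := by
  rw [df_of_eqOn_graphMap hφ hf hx hψ, mfderiv_coordField hφ hx]

theorem metricMatrix_of_eqOn_graphMap (hφ : φ.MDifferentiable (𝓡 2) (𝓡 2))
    (hf : EqOn f (graphMap ψ ∘ φ) φ.source) (hx : x ∈ φ.source)
    (hψ : DifferentiableAt ℝ ψ (φ x)) : metricMatrix f φ x = 1 := by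
  ext i j
  rw [metricMatrix, Matrix.of_apply, inducedMetric, df_coordField_of_eqOn_graphMap hφ hf hx hψ,
    df_coordField_of_eqOn_graphMap hφ hf hx hψ, form_incl_add_smul_xi]
  simp [Matrix.one_apply, EuclideanSpace.inner_single_left]

theorem xi_notMem_range_df_of_eqOn_graphMap (hφ : φ.MDifferentiable (𝓡 2) (𝓡 2))
    (hf : EqOn f (graphMap ψ ∘ φ) φ.source) (hx : x ∈ φ.source)
    (hψ : DifferentiableAt ℝ ψ (φ x)) : xi ∉ range (df f x) := by
  rintro ⟨v, hv⟩
  rw [df_of_eqOn_graphMap hφ hf hx hψ] at hv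
  have hzero : mfderiv (𝓡 2) (𝓡 2) φ x v = (0 : Plane) := by
    rw [← proj_incl_add_smul_xi (mfderiv (𝓡 2) (𝓡 2) φ x v), hv, proj_xi]
  rw [hzero] at hv
  simpa [xi] using congrArg (fun p : Space => p 2) hv

theorem ambientDeriv_coordField_of_eqOn_graphMap (hφ : φ.MDifferentiable (𝓡 2) (𝓡 2))
    (hf : EqOn f (graphMap ψ ∘ φ) φ.source) (hx : x ∈ φ.source)
    (hψ : ContDiffOn ℝ 2 ψ φ.target) (i j : Fin 2) :
    ambientDeriv f (coordField φ i) (coordField φ j) x =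
      fderiv ℝ (fderiv ℝ ψ) (φ x) (EuclideanSpace.single i 1) (EuclideanSpace.single j 1) • xi := by
  set e : Fin 2 → Plane := fun k => EuclideanSpace.single k 1
  have hψ' : ∀ y ∈ φ.source, ContDiffAt ℝ 2 ψ (φ y) := fun y hy =>
    hψ.contDiffAt (φ.open_target.mem_nhds (φ.map_source hy))
  have hlocal : (fun y => df f y (coordField φ j y)) =ᶠ[𝓝 x]
      (fun q => incl (e j) + fderiv ℝ ψ q (e j) • xi) ∘ φ := by
    filter_upwards [φ.open_source.mem_nhds hx] with y hy
    exact df_coordField_of_eqOn_graphMap hφ hf hy ((hψ' y hy).differentiableAt (by simp)) j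
  have hderiv : HasFDerivAt (fun q => incl (e j) + fderiv ℝ ψ q (e j) • xi)
      (((fderiv ℝ (fderiv ℝ ψ) (φ x)).flip (e j)).smulRight xi) (φ x) := by
    have hψ'' : HasFDerivAt (fderiv ℝ ψ) (fderiv ℝ (fderiv ℝ ψ) (φ x)) (φ x) :=
      (((hψ' x hx).fderiv_right (m := 1) (by norm_num)).differentiableAt (by simp)).hasFDerivAt
    have happly : HasFDerivAt (fun q => fderiv ℝ ψ q (e j))
        ((fderiv ℝ (fderiv ℝ ψ) (φ x)).flip (e j)) (φ x) := by
      simpa using hψ''.clm_apply (hasFDerivAt_const (e j) _)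
    exact (happly.smul_const xi).const_add _
  rw [ambientDeriv,
    mfderiv_apply_of_eventuallyEq_comp hderiv (hφ.mdifferentiableAt hx) hlocal,
    mfderiv_coordField hφ hx]
  rfl

theorem secondFundMatrix_of_eqOn_graphMap (hφ : φ.MDifferentiable (𝓡 2) (𝓡 2))
    (hf : EqOn f (graphMap ψ ∘ φ) φ.source) (hx : x ∈ φ.source)
    (hψ : ContDiffOn ℝ 2 ψ φ.target) (i j : Fin 2) :
    secondFundMatrix f φ x i j =
      fderiv ℝ (fderiv ℝ ψ) (φ x) (EuclideanSpace.single i 1) (EuclideanSpace.single j 1) := by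
  have hψx : DifferentiableAt ℝ ψ (φ x) :=
    (hψ.contDiffAt (φ.open_target.mem_nhds (φ.map_source hx))).differentiableAt (by simp)
  rw [secondFundMatrix, Matrix.of_apply, secondFundForm,
    ambientDeriv_coordField_of_eqOn_graphMap hφ hf hx hψ]
  simpa using normalCoeff_df_add_smul_xi (xi_notMem_range_df_of_eqOn_graphMap hφ hf hx hψx) 0 _

theorem meanCurvature_of_eqOn_graphMap (hφ : φ.MDifferentiable (𝓡 2) (𝓡 2))
    (hf : EqOn f (graphMap ψ ∘ φ) φ.source) (hx : x ∈ φ.source)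
    (hψ : ContDiffOn ℝ 2 ψ φ.target) :
    meanCurvature f φ x = 1 / 2 * Laplacian.laplacian ψ (φ x) := by
  have hψx : DifferentiableAt ℝ ψ (φ x) :=
    (hψ.contDiffAt (φ.open_target.mem_nhds (φ.map_source hx))).differentiableAt (by simp)
  rw [meanCurvature, metricMatrix_of_eqOn_graphMap hφ hf hx hψx, inv_one,
    InnerProductSpace.laplacian_eq_iteratedFDeriv_orthonormalBasis _
      (EuclideanSpace.basisFun (Fin 2) ℝ)]
  simp [secondFundMatrix_of_eqOn_graphMap hφ hf hx hψ, iteratedFDeriv_two_apply]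

theorem IsDMinimal.laplacian_eq_zero [IsManifold (𝓡 2) ∞ M] (hf : IsDMinimal f)
    (Φ : M ≃ₘ^∞⟮𝓡 2, 𝓡 2⟯ Plane) (hψ : ContDiff ℝ 2 ψ) (hgraph : f = graphMap ψ ∘ Φ) (q : Plane) :
    Laplacian.laplacian ψ q = 0 := by
  let φ := Φ.toHomeomorph.toOpenPartialHomeomorph
  have hatlas : φ ∈ IsManifold.maximalAtlas (𝓡 2) ∞ M :=
    φ.mem_maximalAtlas_of_contMDiffOn Φ.contMDiff.contMDiffOn Φ.symm.contMDiff.contMDiffOn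
  have hφ : φ.MDifferentiable (𝓡 2) (𝓡 2) :=
    ⟨(Φ.mdifferentiable (by simp)).mdifferentiableOn,
      (Φ.symm.mdifferentiable (by simp)).mdifferentiableOn⟩
  have hmean : 1 / 2 * Laplacian.laplacian ψ (φ (Φ.symm q)) = 0 :=
    (meanCurvature_of_eqOn_graphMap hφ (fun x _ => congrFun hgraph x) (mem_univ _)
      hψ.contDiffOn).symm.trans (hf.meanCurvature_eq_zero φ hatlas (Φ.symm q) (mem_univ _))
  simpa [φ] using hmean

end Graph

end Isotropic

theorem corollary4p1 {M : Type*} [TopologicalSpace M] [T2Space M] [ConnectedSpace M]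
    [ChartedSpace Isotropic.Plane M] [IsManifold (𝓡 2) ∞ M]
    (f : M → Isotropic.Space) (hmin : Isotropic.IsDMinimal f)
    (hcomplete : Isotropic.IsCompleteSurface f) :
    ∃ ψ : Isotropic.Plane → ℝ,
      ContDiff ℝ ∞ ψ ∧ InnerProductSpace.HarmonicOnNhd ψ Set.univ ∧
      Set.range f = {p : Isotropic.Space | ∃ u v : ℝ, p = !₂[u, v, ψ !₂[u, v]]} := by
  have hf := hmin.nondegenerate
  obtain ⟨Φ, hΦ⟩ := hf.exists_diffeomorph_proj hcomplete
  let ψ : Isotropic.Plane → ℝ := fun q => f (Φ.symm q) 2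
  have hgraph : f = Isotropic.graphMap ψ ∘ Φ := Isotropic.eq_graphMap_comp_of_proj_eq Φ.toEquiv hΦ
  have hψ : ContDiff ℝ ∞ ψ :=
    (EuclideanSpace.proj (𝕜 := ℝ) (2 : Fin 3)).contDiff.comp
      (hf.contMDiff.comp Φ.symm.contMDiff).contDiff
  have hψ2 : ContDiff ℝ 2 ψ := contDiff_infty.1 hψ 2
  refine ⟨ψ, hψ, fun q _ => ⟨hψ2.contDiffAt, .of_forall ?_⟩, ?_⟩
  · exact hmin.laplacian_eq_zero Φ hψ2 hgraph
  · rw [← Isotropic.range_graphMap]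
    exact (congrArg Set.range hgraph).trans (Φ.toEquiv.surjective.range_comp _)
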